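/- Let $m\in\mathbb N$, let $S^{m-1}=\{x\in\mathbb R^m : x_i\ge 0 \text{ for all } i,\ \sum_{i=1}^m x_i=1\}$, and let $\|\cdot\|$ be the Euclidean norm on $\mathbb R^m$. A map $V:S^{m-1}\to S^{m-1}$ is a quadratic stochastic Volterra operator if $(Vx)_k=\sum_{i,j=1}^m P_{ij,k}x_ix_j$ for all $k$, where $P_{ij,k}=P_{ji,k}\ge 0$, $\sum_{k=1}^m P_{ij,k}=1$, and $P_{ij,k}=0$ whenever $k\notin\{i,j\}$. Every such operator can be written as $$(Vx)_k=x_k\Bigl(1+\sum_{i=1}^m a_{ki}x_i\Bigr),\qquad k=1,\dots,m,$$ with a skew-symmetric real matrix $A=(a_{ki})_{k,i=1}^m$ whose entries lie in $[-1,1]$. The operator $V$ is called transversal if all principal minors of $A$ of even order are nonzero. In that case $a_{ij}\ne 0$ for all $i\neq j$, and the tournament of $V$ is the directed graph on $\{1,\dots,m\}$ in which, for $i\ne j$, the edge is directed from $i$ to $j$ if $a_{ij}<0$ and from $j$ to $i$ otherwise. **Theorem.** Let $V$ be a transversal quadratic stochastic Volterra operator on $S^{m-1}$, with matrix $A$ as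 above. The following four statements are equivalent: (i) $V$ is regular: for every $x\in S^{m-1}$ the trajectory $(V^n x)_{n\ge 0}$ converges to some fixed point of $V$ (which may depend on $x$); (ii) $V$ is transitive: the tournament of $V$ contains no cycle of length $3$; (iii) $V$ satisfies the Ergodic principle: $\lim_{n\to\infty}\|V^n x-V^n y\|=0$ for all $x,y\in S^{m-1}$ with $\operatorname{supp}(x)=\operatorname{supp}(y)$, where $\operatorname{supp}(x)=\{i : x_i\neq 0\}$; (iv) $\lim_{n\to\infty}\|V^n x-V^{n+1}x\|=0$ for every $x\in S^{m-1}$. -/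

import Mathlib

open Filter Topology

namespace QuadraticStochastic

/-- The simplex `S^{m-1}` inside `ℝ^m` with the Euclidean norm. -/
def simplex (m : ℕ) : Set (EuclideanSpace ℝ (Fin m)) :=
  {x | (∀ i, 0 ≤ x i) ∧ ∑ i, x i = 1}

/-- `P i j k` is the coefficient `P_{ij,k}`: it is symmetric in `i, j`, nonnegative, and sums to
one over `k`. -/
structure IsStochasticCoeff {m : ℕ} (P : Fin m → Fin m → Fin m → ℝ) : Prop where
  symm : ∀ i j k, P i j k = P j i k
  nonneg : ∀ i j k, 0 ≤ P i j k
  sum_eq_one : ∀ i j, ∑ k, P i j k = 1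

/-- A quadratic stochastic Volterra operator: a quadratic stochastic operator
`(V x)_k = ∑_{i,j} P_{ij,k} x_i x_j` with `P_{ij,k} = 0` whenever `k ∉ {i, j}`. -/
def IsVolterra {m : ℕ} (V : simplex m → simplex m) : Prop :=
  ∃ P : Fin m → Fin m → Fin m → ℝ, IsStochasticCoeff P ∧
    (∀ i j k, k ≠ i → k ≠ j → P i j k = 0) ∧
    ∀ (x : simplex m) (k : Fin m), (V x).1 k = ∑ i, ∑ j, P i j k * x.1 i * x.1 j

/-- `V` is given by the skew-symmetric matrix `A` with entries in `[-1, 1]`: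
`(V x)_k = x_k (1 + ∑_i a_{ki} x_i)`. -/
structure IsGivenBy {m : ℕ} (V : simplex m → simplex m) (A : Matrix (Fin m) (Fin m) ℝ) :
    Prop where
  skew : A.transpose = -A
  mem_Icc : ∀ k i, A k i ∈ Set.Icc (-1 : ℝ) 1
  apply_eq : ∀ (x : simplex m) (k : Fin m), (V x).1 k = x.1 k * (1 + ∑ i, A k i * x.1 i)

/-- Every principal minor of even order is nonzero. (The minor on the empty index set is `1`.) -/
def IsTransversal {m : ℕ} (A : Matrix (Fin m) (Fin m) ℝ) : Prop :=
  ∀ s : Finset (Fin m), Even s.card →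
    (A.submatrix (fun i : s => (i : Fin m)) (fun i : s => (i : Fin m))).det ≠ 0

/-- The directed graph of `A`: for `i ≠ j` there is an edge from `i` to `j` if `a_{ij} < 0`. It is
a tournament when `A` is skew-symmetric with nonzero off-diagonal entries, in particular when `A`
is skew-symmetric and transversal: if `a_{ij} > 0` then `a_{ji} < 0` and the edge is directed
from `j` to `i`. -/
def tournament {m : ℕ} (A : Matrix (Fin m) (Fin m) ℝ) : Digraph (Fin m) where
  Adj i j := i ≠ j ∧ A i j < 0

/-- A tournament is transitive if it contains no cycle of length `3`. -/
def IsTransitiveTournament {α : Type*} (T : Digraph α) : Prop :=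
  ¬ ∃ i j k : α, i ≠ j ∧ j ≠ k ∧ k ≠ i ∧ T.Adj i j ∧ T.Adj j k ∧ T.Adj k i

/-- Every trajectory converges to a fixed point (which may depend on the starting point). -/
def IsRegularOperator {m : ℕ} (V : simplex m → simplex m) : Prop :=
  ∀ x : simplex m, ∃ p : simplex m, V p = p ∧ Tendsto (fun n : ℕ => V^[n] x) atTop (𝓝 p)

/-- The support of a point of the simplex. -/
def supp {m : ℕ} (x : simplex m) : Set (Fin m) := {i | x.1 i ≠ 0}

/-- The Ergodic principle. -/
def ErgodicPrinciple {m : ℕ} (V : simplex m → simplex m) : Prop :=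
  ∀ x y : simplex m, supp x = supp y →
    Tendsto (fun n : ℕ => ‖(V^[n] x).1 - (V^[n] y).1‖) atTop (𝓝 0)

end QuadraticStochastic

open QuadraticStochastic

/-!
Every trajectory keeps its support, so the whole question is about the restriction of the
tournament to the support of the starting point.

If the tournament has no 3-cycle, it is a strict order on its vertices, and the support of `x` has a
greatest element `j`, i.e. `0 < A j k` for every other `k` in the support
(`exists_dominant_of_transitive`). The `j`-th coordinate is then nondecreasing and bounded, its
increments tend to zero, and these increments dominate a positive multiple of every other
coordinate. So the trajectory converges to the vertex `j` (`tendsto_vertex_of_dominant`). As `j`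
depends on the support only, this gives regularity and the Ergodic principle. Each of these two
forces consecutive iterates to approach each other.

Conversely, a 3-cycle gives an invariant two-dimensional face on which `V` acts as a
rock-paper-scissors map with weights `a, b, c > 0`. The function
`a log x + b log y + c log z` does not increase along an orbit and has a strict maximum at the
interior fixed point `(a, b, c) / (a + b + c)`, so an orbit starting in the interior at another point
stays away from that point. If its steps tended to zero, it would have to approach the set of
remaining fixed points, the three vertices, and hence a single vertex; but each vertex repels one
of the coordinates. This is `not_tendsto_steps_of_cyclic`.
-/

namespace QuadraticStochastic

/-! ### Rock-paper-scissors recurrences -/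

/-- A sequence in `[0, 1]` whose steps tend to zero and which accumulates only at `0` and `1`
converges to one of them: it cannot jump over the middle of the interval. -/
lemma tendsto_zero_or_one_of_mul_one_sub {w : ℕ → ℝ} (h0 : ∀ n, 0 ≤ w n) (h1 : ∀ n, w n ≤ 1)
    (hstep : Tendsto (fun n => w (n + 1) - w n) atTop (𝓝 0))
    (hw : Tendsto (fun n => w n * (1 - w n)) atTop (𝓝 0)) :
    Tendsto w atTop (𝓝 0) ∨ Tendsto w atTop (𝓝 1) := by
  have e1 : ∀ᶠ n in atTop, |w (n + 1) - w n| < 1 / 4 := by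
    have := (tendsto_order.1 hstep.abs).2 (1 / 4) (by norm_num)
    exact this
  have e2 : ∀ᶠ n in atTop, w n * (1 - w n) < 3 / 16 := (tendsto_order.1 hw).2 _ (by norm_num)
  obtain ⟨N, hN⟩ := eventually_atTop.1 (e1.and e2)
  have hout : ∀ n ≥ N, w n < 1 / 4 ∨ 3 / 4 < w n := by
    intro n hn
    by_contra! h
    nlinarith [(hN n hn).2, h.1, h.2]
  rcases hout N le_rfl with hs | hs
  · left
    have hall : ∀ n ≥ N, w n < 1 / 4 := by
      intro n hn
      induction n, hn using Nat.le_induction with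
      | base => exact hs
      | succ n hn ih =>
        have := abs_lt.1 (hN n hn).1
        rcases hout (n + 1) (by omega) with h | h
        · exact h
        · linarith
    refine squeeze_zero' (Eventually.of_forall h0) ?_ (by simpa using hw.const_mul 2)
    filter_upwards [eventually_ge_atTop N] with n hn
    nlinarith [hall n hn, h0 n]
  · right
    have hall : ∀ n ≥ N, 3 / 4 < w n := by
      intro n hn
      induction n, hn using Nat.le_induction with
      | base => exact hs
      | succ n hn ih =>
        have := abs_lt.1 (hN n hn).1
        rcases hout (n + 1) (by omega) with h | h
        · linarith
        · exact h
    have : Tendsto (fun n => 1 - w n) atTop (𝓝 0) := by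
      refine squeeze_zero' (Eventually.of_forall fun n => sub_nonneg.2 (h1 n)) ?_
        (by simpa using hw.const_mul 2)
      filter_upwards [eventually_ge_atTop N] with n hn
      nlinarith [hall n hn, h1 n]
    simpa using this.const_sub 1

/-- The vertex `x = 1` repels: near it, the coordinate `y` does not decrease. -/
lemma not_tendsto_one_of_growth {x y z : ℕ → ℝ} {a c : ℝ} (hc : 0 < c)
    (hy : ∀ n, 0 < y n) (hz : ∀ n, 0 ≤ z n) (hsum : ∀ n, x n + y n + z n = 1)
    (hy' : ∀ n, y (n + 1) = y n * (1 + (c * x n - a * z n))) : ¬ Tendsto x atTop (𝓝 1) := by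
  intro h
  have hyz : Tendsto (fun n => 1 - x n) atTop (𝓝 0) := by simpa using h.const_sub 1
  have hy0 : Tendsto y atTop (𝓝 0) :=
    squeeze_zero (fun n => (hy n).le) (fun n => by linarith [hsum n, hz n]) hyz
  have hz0 : Tendsto z atTop (𝓝 0) :=
    squeeze_zero hz (fun n => by linarith [hsum n, hy n]) hyz
  have hlim : Tendsto (fun n => c * x n - a * z n) atTop (𝓝 c) := by
    simpa using (h.const_mul c).sub (hz0.const_mul a)
  obtain ⟨N, hN⟩ := eventually_atTop.1 ((tendsto_order.1 hlim).1 0 hc)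
  have hge : ∀ n ≥ N, y N ≤ y n := by
    intro n hn
    induction n, hn using Nat.le_induction with
    | base => exact le_rfl
    | succ n hn ih =>
      rw [hy']
      nlinarith [hN n hn, hy n]
  have := ge_of_tendsto hy0 (eventually_atTop.2 ⟨N, hge⟩)
  linarith [hy N]

/-- The function `a log x + b log y + c log z` on the open triangle is maximal at the
point proportional to `(a, b, c)`. Strictness is only needed, and only asserted, for points with a
different first coordinate. -/
lemma weighted_log_lt {a b c x y z : ℝ} (ha : 0 < a) (hb : 0 < b) (hc : 0 < c) (hx : 0 < x)
    (hy : 0 < y) (hz : 0 < z) (hsum : x + y + z = 1) (hne : x ≠ a / (a + b + c)) :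
    a * Real.log x + b * Real.log y + c * Real.log z <
      a * Real.log (a / (a + b + c)) + b * Real.log (b / (a + b + c)) +
        c * Real.log (c / (a + b + c)) := by
  have hs : 0 < a + b + c := by positivity
  set s := a + b + c with hsdef
  have key : ∀ {u v : ℝ}, 0 < u → 0 < v →
      u * Real.log v - u * Real.log (u / s) ≤ v * s - u := by
    intro u v hu hv
    have hp : 0 < v / (u / s) := by positivity
    have h := Real.log_le_sub_one_of_pos hp
    rw [Real.log_div hv.ne' (by positivity)] at h
    calc _ = u * (Real.log v - Real.log (u / s)) := by ring
      _ ≤ u * (v / (u / s) - 1) := by gcongr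
      _ = _ := by field_simp
  have key' : a * Real.log x - a * Real.log (a / s) < x * s - a := by
    have hp : 0 < x / (a / s) := by positivity
    have hn : x / (a / s) ≠ 1 := by
      rw [ne_eq, div_eq_one_iff_eq (by positivity)]
      exact hne
    have h := Real.log_lt_sub_one_of_pos hp hn
    rw [Real.log_div hx.ne' (by positivity)] at h
    calc _ = a * (Real.log x - Real.log (a / s)) := by ring
      _ < a * (x / (a / s) - 1) := by gcongr
      _ = _ := by field_simp
  have e : (x * s - a) + (y * s - b) + (z * s - c) = 0 := by
    have : (x + y + z) * s = a + b + c := by rw [hsum, one_mul]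
    linarith
  linarith [key hb hy, key hc hz]

/-- An interior orbit of the rock-paper-scissors map that does not start at the fixed point has
steps that do not tend to zero. -/
theorem not_tendsto_steps_of_cyclic {x y z : ℕ → ℝ} {a b c : ℝ} (ha : 0 < a) (hb : 0 < b)
    (hc : 0 < c) (hx : ∀ n, 0 < x n) (hy : ∀ n, 0 < y n) (hz : ∀ n, 0 < z n)
    (hsum : ∀ n, x n + y n + z n = 1)
    (hx' : ∀ n, x (n + 1) = x n * (1 + (b * z n - c * y n)))
    (hy' : ∀ n, y (n + 1) = y n * (1 + (c * x n - a * z n)))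
    (hz' : ∀ n, z (n + 1) = z n * (1 + (a * y n - b * x n)))
    (hne : x 0 ≠ a / (a + b + c))
    (sx : Tendsto (fun n => x (n + 1) - x n) atTop (𝓝 0))
    (sy : Tendsto (fun n => y (n + 1) - y n) atTop (𝓝 0))
    (sz : Tendsto (fun n => z (n + 1) - z n) atTop (𝓝 0)) : False := by
  have hs : 0 < a + b + c := by positivity
  have hx1 : ∀ n, x n ≤ 1 := fun n => by linarith [hsum n, hy n, hz n]
  have hy1 : ∀ n, y n ≤ 1 := fun n => by linarith [hsum n, hx n, hz n]
  have hz1 : ∀ n, z n ≤ 1 := fun n => by linarith [hsum n, hx n, hy n]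
  set L : ℕ → ℝ := fun n => a * Real.log (x n) + b * Real.log (y n) + c * Real.log (z n) with hL
  have hlog : ∀ {u v t : ℝ}, 0 < u → 0 < v → v = u * (1 + t) →
      Real.log v ≤ Real.log u + t := by
    intro u v t hu hv h
    have ht : 0 < 1 + t := by
      by_contra! h'
      nlinarith
    rw [h, Real.log_mul hu.ne' ht.ne']
    linarith [Real.log_le_sub_one_of_pos ht]
  -- The first-order terms cancel because `(a, b, c)` is in the kernel of the skew matrix.
  have hanti : Antitone L := by
    refine antitone_nat_of_succ_le fun n => ?_
    have h1 := mul_le_mul_of_nonneg_left (hlog (hx n) (hx (n + 1)) (hx' n)) ha.le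
    have h2 := mul_le_mul_of_nonneg_left (hlog (hy n) (hy (n + 1)) (hy' n)) hb.le
    have h3 := mul_le_mul_of_nonneg_left (hlog (hz n) (hz (n + 1)) (hz' n)) hc.le
    simp only [hL]
    linarith
  have hL0 := weighted_log_lt ha hb hc (hx 0) (hy 0) (hz 0) (hsum 0) hne
  have tx : Tendsto (fun n => x n * (b * z n - c * y n)) atTop (𝓝 0) :=
    sx.congr fun n => by rw [hx']; ring
  have ty : Tendsto (fun n => y n * (c * x n - a * z n)) atTop (𝓝 0) :=
    sy.congr fun n => by rw [hy']; ring
  have tz : Tendsto (fun n => z n * (a * y n - b * x n)) atTop (𝓝 0) :=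
    sz.congr fun n => by rw [hz']; ring
  have hbdd : ∀ {f g : ℕ → ℝ}, Tendsto f atTop (𝓝 0) → (∀ n, 0 < g n) → (∀ n, g n ≤ 1) →
      Tendsto (fun n => f n * g n) atTop (𝓝 0) := by
    intro f g hf h0 h1
    refine squeeze_zero_norm (fun n => ?_) (tendsto_zero_iff_norm_tendsto_zero.1 hf)
    rw [norm_mul, Real.norm_of_nonneg (h0 n).le]
    exact mul_le_of_le_one_right (norm_nonneg _) (h1 n)
  -- Along the times with `ε ≤ x y z` the orbit would approach the interior fixed point.
  have hxyz : Tendsto (fun n => x n * y n * z n) atTop (𝓝 0) := by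
    have hpos : ∀ n, 0 < x n * y n * z n := fun n => mul_pos (mul_pos (hx n) (hy n)) (hz n)
    refine tendsto_order.2 ⟨fun r hr => Eventually.of_forall fun n => hr.trans (hpos n), ?_⟩
    intro ε hε
    by_contra hcon
    have hfreq : ∃ᶠ n in atTop, ε ≤ x n * y n * z n := by
      simpa only [Filter.not_eventually, not_lt] using hcon
    set F : Filter ℕ := atTop ⊓ 𝓟 {n | ε ≤ x n * y n * z n} with hF
    have hFne : F.NeBot := frequently_mem_iff_neBot.1 hfreq
    have hFle : F ≤ atTop := inf_le_left
    have hFmem : ∀ᶠ n in F, ε ≤ x n * y n * z n :=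
      mem_inf_of_right (mem_principal_self _)
    have hdiv : ∀ {f g : ℕ → ℝ}, Tendsto (fun n => f n * g n) atTop (𝓝 0) →
        (∀ n, x n * y n * z n ≤ f n) → Tendsto g F (𝓝 0) := by
      intro f g hfg hf
      refine squeeze_zero_norm' (a := fun n => ε⁻¹ * ‖f n * g n‖) ?_ ?_
      · filter_upwards [hFmem] with n hn
        have hεf : ε ≤ f n := hn.trans (hf n)
        have hf0 : 0 < f n := hε.trans_le hεf
        rw [norm_mul, Real.norm_of_nonneg hf0.le, ← mul_assoc]
        refine le_mul_of_one_le_left (norm_nonneg _) ?_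
        rw [inv_mul_eq_div]
        exact (one_le_div hε).2 hεf
      · simpa using ((hfg.mono_left hFle).norm).const_mul ε⁻¹
    have hxy : ∀ n, x n * y n ≤ 1 := fun n => mul_le_one₀ (hx1 n) (hy n).le (hy1 n)
    have rx := hdiv tx fun n => by
      rw [mul_assoc]
      exact mul_le_of_le_one_right (hx n).le (mul_le_one₀ (hy1 n) (hz n).le (hz1 n))
    have ry := hdiv ty fun n => by
      rw [mul_comm (x n), mul_assoc]
      exact mul_le_of_le_one_right (hy n).le (mul_le_one₀ (hx1 n) (hz n).le (hz1 n))
    have rz := hdiv tz fun n => mul_le_of_le_one_left (hz n).le (hxy n)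
    have lim : ∀ {w g : ℕ → ℝ} {u : ℝ}, Tendsto g F (𝓝 0) →
        (∀ n, w n = (u + g n) / (a + b + c)) → Tendsto w F (𝓝 (u / (a + b + c))) := by
      intro w g u hg hw
      have := (hg.const_add u).div_const (a + b + c)
      rw [add_zero] at this
      exact this.congr fun n => (hw n).symm
    have lx : Tendsto x F (𝓝 (a / (a + b + c))) := by
      refine lim (g := fun n => (c * x n - a * z n) - (a * y n - b * x n))
        (by simpa using ry.sub rz) fun n => ?_
      rw [eq_div_iff hs.ne']
      linear_combination a * hsum n
    have ly : Tendsto y F (𝓝 (b / (a + b + c))) := by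
      refine lim (g := fun n => (a * y n - b * x n) - (b * z n - c * y n))
        (by simpa using rz.sub rx) fun n => ?_
      rw [eq_div_iff hs.ne']
      linear_combination b * hsum n
    have lz : Tendsto z F (𝓝 (c / (a + b + c))) := by
      refine lim (g := fun n => (b * z n - c * y n) - (c * x n - a * z n))
        (by simpa using rx.sub ry) fun n => ?_
      rw [eq_div_iff hs.ne']
      linear_combination c * hsum n
    have lL := (((lx.log (by positivity)).const_mul a).add
      ((ly.log (by positivity)).const_mul b)).add ((lz.log (by positivity)).const_mul c)
    have := le_of_tendsto lL (Eventually.of_forall fun n => hanti (Nat.zero_le n))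
    exact absurd hL0 (not_lt.2 this)
  -- Two of the steps, each multiplied by the other coordinate, differ by `r u v (u + v)` up to
  -- multiples of `u v w`, so products of two coordinates tend to zero as well.
  have hprod : ∀ {u v w : ℕ → ℝ} {p q r : ℝ}, 0 < r → (∀ n, 0 < u n) → (∀ n, 0 < v n) →
      (∀ n, u n ≤ 1) → (∀ n, v n ≤ 1) → (∀ n, u n + v n + w n = 1) →
      Tendsto (fun n => u n * v n * w n) atTop (𝓝 0) →
      Tendsto (fun n => u n * (q * w n - r * v n)) atTop (𝓝 0) →
      Tendsto (fun n => v n * (r * u n - p * w n)) atTop (𝓝 0) →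
      Tendsto (fun n => u n * v n) atTop (𝓝 0) := by
    intro u v w p q r hr hu hv hu1 hv1 hs1 huvw hU hW
    have h1 := hbdd hU hv hv1
    have h2 := hbdd hW hu hu1
    have h3 := (h2.sub h1).add (huvw.const_mul (q + p + r))
    have h4 := h3.const_mul r⁻¹
    simp only [sub_zero, mul_zero, add_zero] at h4
    refine h4.congr fun n => ?_
    rw [inv_mul_eq_iff_eq_mul₀ hr.ne']
    linear_combination (r * u n * v n) * hs1 n
  have pxy := hprod hc hx hy hx1 hy1 hsum hxyz tx ty
  have pyz := hprod ha hy hz hy1 hz1 (fun n => by linarith [hsum n])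
    (hxyz.congr fun n => by ring) ty tz
  have pzx := hprod hb hz hx hz1 hx1 (fun n => by linarith [hsum n])
    (hxyz.congr fun n => by ring) tz tx
  have cx := tendsto_zero_or_one_of_mul_one_sub (fun n => (hx n).le) hx1 sx <| by
    have := pxy.add pzx
    rw [add_zero] at this
    exact this.congr fun n => by linear_combination x n * hsum n
  have cy := tendsto_zero_or_one_of_mul_one_sub (fun n => (hy n).le) hy1 sy <| by
    have := pyz.add pxy
    rw [add_zero] at this
    exact this.congr fun n => by linear_combination y n * hsum n
  have cz := tendsto_zero_or_one_of_mul_one_sub (fun n => (hz n).le) hz1 sz <| by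
    have := pzx.add pyz
    rw [add_zero] at this
    exact this.congr fun n => by linear_combination z n * hsum n
  have nx := not_tendsto_one_of_growth hc hy (fun n => (hz n).le) hsum hy'
  have ny := not_tendsto_one_of_growth ha hz (fun n => (hx n).le)
    (fun n => by linarith [hsum n]) hz'
  have nz := not_tendsto_one_of_growth hb hx (fun n => (hy n).le)
    (fun n => by linarith [hsum n]) hx'
  have h := ((cx.resolve_right nx).add (cy.resolve_right ny)).add (cz.resolve_right nz)
  simp only [hsum, add_zero] at h
  exact one_ne_zero (tendsto_nhds_unique tendsto_const_nhds h)

/-! ### Volterra operators -/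

variable {m : ℕ} {V : simplex m → simplex m} {A : Matrix (Fin m) (Fin m) ℝ}

lemma IsGivenBy.apply_swap (hA : IsGivenBy V A) (i j : Fin m) : A j i = -A i j := by
  have := congrFun (congrFun hA.skew i) j
  simpa using this

lemma IsGivenBy.apply_self (hA : IsGivenBy V A) (i : Fin m) : A i i = 0 := by
  linarith [hA.apply_swap i i]

lemma IsTransversal.apply_ne_zero (hT : IsTransversal A) (hA : IsGivenBy V A) {i j : Fin m}
    (hij : i ≠ j) : A i j ≠ 0 := by
  intro h0
  refine hT {i, j} (by rw [Finset.card_pair hij]; exact even_two) ?_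
  have hji : A j i = 0 := by rw [hA.apply_swap, h0, neg_zero]
  have hne : Nonempty ({i, j} : Finset (Fin m)) := ⟨⟨i, by simp⟩⟩
  rw [← Matrix.det_zero (n := ({i, j} : Finset (Fin m))) (R := ℝ)]
  congr 1
  ext ⟨p, hp⟩ ⟨q, hq⟩
  rw [Finset.mem_insert, Finset.mem_singleton] at hp hq
  rcases hp with rfl | rfl <;> rcases hq with rfl | rfl <;> simp [hA.apply_self, h0, hji]

lemma simplex_apply_le_one (x : simplex m) (k : Fin m) : x.1 k ≤ 1 := by
  rw [← x.2.2]
  exact Finset.single_le_sum (f := fun i => x.1 i) (fun i _ => x.2.1 i) (Finset.mem_univ k)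

/-- Entries equal to `-1` do no harm: the coefficient of `x k` in its own growth rate is
`A k k = 0`, so a positive coordinate stays positive. -/
lemma IsGivenBy.apply_pos (hA : IsGivenBy V A) (x : simplex m) {k : Fin m} (hk : 0 < x.1 k) :
    0 < (V x).1 k := by
  rw [hA.apply_eq]
  refine mul_pos hk ?_
  have : 0 < ∑ i, (1 + A k i) * x.1 i := by
    refine Finset.sum_pos' (fun i _ => mul_nonneg ?_ (x.2.1 i)) ⟨k, Finset.mem_univ k, ?_⟩
    · linarith [(hA.mem_Icc k i).1]
    · rwa [hA.apply_self, add_zero, one_mul]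
  simpa only [add_mul, one_mul, Finset.sum_add_distrib, x.2.2] using this

lemma IsGivenBy.supp_apply (hA : IsGivenBy V A) (x : simplex m) : supp (V x) = supp x := by
  ext k
  simp only [supp, Set.mem_ofPred_eq]
  constructor
  · intro h h0
    exact h (by rw [hA.apply_eq, h0, zero_mul])
  · intro h
    exact (hA.apply_pos x (lt_of_le_of_ne (x.2.1 k) (Ne.symm h))).ne'

lemma IsGivenBy.supp_iterate (hA : IsGivenBy V A) (x : simplex m) (n : ℕ) :
    supp (V^[n] x) = supp x := by
  induction n with
  | zero => rfl
  | succ n ih => rw [Function.iterate_succ_apply', hA.supp_apply, ih]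

lemma tendsto_simplex_iff {u : ℕ → simplex m} {p : simplex m} :
    Tendsto u atTop (𝓝 p) ↔ ∀ k, Tendsto (fun n => (u n).1 k) atTop (𝓝 (p.1 k)) := by
  rw [tendsto_subtype_rng]
  constructor
  · intro h k
    exact ((EuclideanSpace.proj (𝕜 := ℝ) k).continuous.tendsto p.1).comp h
  · intro h
    have := tendsto_pi_nhds.2 h
    exact ((PiLp.continuous_toLp 2 (fun _ : Fin m => ℝ)).tendsto _).comp this

/-! ### Transitive tournaments -/

/-- The vertex of the simplex with index `j`. -/
noncomputable def vertex (j : Fin m) : simplex m :=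
  ⟨EuclideanSpace.single j 1, fun i => by
    rw [PiLp.single_apply]
    split_ifs <;> norm_num, by simp⟩

lemma vertex_apply (j k : Fin m) : (vertex j).1 k = if k = j then 1 else 0 := by
  simp [vertex]

lemma IsGivenBy.apply_vertex (hA : IsGivenBy V A) (j : Fin m) : V (vertex j) = vertex j := by
  apply Subtype.ext
  ext k
  rw [hA.apply_eq]
  simp only [vertex_apply, mul_ite, mul_one, mul_zero, Finset.sum_ite_eq', Finset.mem_univ, if_true]
  split_ifs with h
  · rw [h, hA.apply_self, add_zero, mul_one]
  · rw [zero_mul]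

/-- A tournament without 3-cycles is a strict order, so the support of `x` has a greatest
element. -/
lemma exists_dominant_of_transitive (hA : IsGivenBy V A) (hT : IsTransversal A)
    (h : IsTransitiveTournament (tournament A)) (x : simplex m) :
    ∃ j ∈ supp x, ∀ k ∈ supp x, k ≠ j → 0 < A j k := by
  have htrans : IsTrans (Fin m) fun i j => (tournament A).Adj i j := by
    refine ⟨fun i j k hij hjk => ?_⟩
    have hik : i ≠ k := by
      rintro rfl
      linarith [hA.apply_swap i j, hij.2, hjk.2]
    refine ⟨hik, ?_⟩
    by_contra! hle
    refine h ⟨i, j, k, hij.1, hjk.1, hik.symm, hij, hjk, hik.symm, ?_⟩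
    have := lt_of_le_of_ne hle (hT.apply_ne_zero hA hik).symm
    linarith [hA.apply_swap i k]
  have hirr : Std.Irrefl fun i j => (tournament A).Adj i j := ⟨fun i hi => hi.1 rfl⟩
  have hwf : WellFounded (Function.swap fun i j => (tournament A).Adj i j) :=
    Finite.wellFounded_of_trans_of_irrefl _
  have hne : (supp x).Nonempty := by
    by_contra! hemp
    have hzero : ∀ i, x.1 i = 0 := fun i => by
      by_contra hi
      exact (Set.eq_empty_iff_forall_notMem.1 hemp i) hi
    have := x.2.2
    simp [hzero] at this
  obtain ⟨j, hj, hmax⟩ := hwf.has_min (supp x) hne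
  refine ⟨j, hj, fun k hk hkj => ?_⟩
  by_contra! hle
  exact hmax k hk ⟨hkj.symm, lt_of_le_of_ne hle (hT.apply_ne_zero hA hkj.symm)⟩

/-- If `j` beats every other index of the support of `x`, the trajectory of `x` converges to the
vertex `j`. -/
lemma tendsto_vertex_of_dominant (hA : IsGivenBy V A) (x : simplex m) {j : Fin m}
    (hj : j ∈ supp x) (hdom : ∀ k ∈ supp x, k ≠ j → 0 < A j k) :
    Tendsto (fun n => V^[n] x) atTop (𝓝 (vertex j)) := by
  set u : ℕ → Fin m → ℝ := fun n k => (V^[n] x).1 k with hu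
  have hu0 : ∀ n k, 0 ≤ u n k := fun n k => (V^[n] x).2.1 k
  have hsupp : ∀ n k, k ∉ supp x → u n k = 0 := by
    intro n k hk
    rw [← hA.supp_iterate x n] at hk
    simpa [supp] using hk
  have hterm : ∀ n k, 0 ≤ A j k * u n k := by
    intro n k
    by_cases hk : k ∈ supp x
    · by_cases hkj : k = j
      · rw [hkj, hA.apply_self, zero_mul]
      · exact mul_nonneg (hdom k hk hkj).le (hu0 n k)
    · rw [hsupp n k hk, mul_zero]
  have hsucc : ∀ n, u (n + 1) j = u n j * (1 + ∑ i, A j i * u n i) := by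
    intro n
    simp only [hu]
    rw [Function.iterate_succ_apply', hA.apply_eq]
  have hmono : Monotone fun n => u n j := by
    refine monotone_nat_of_le_succ fun n => ?_
    rw [hsucc]
    have : 0 ≤ ∑ i, A j i * u n i := Finset.sum_nonneg fun i _ => hterm n i
    nlinarith [hu0 n j]
  have hbdd : BddAbove (Set.range fun n => u n j) :=
    ⟨1, by rintro _ ⟨n, rfl⟩; exact simplex_apply_le_one _ _⟩
  have hlim := tendsto_atTop_ciSup hmono hbdd
  have hdiff : Tendsto (fun n => u (n + 1) j - u n j) atTop (𝓝 0) := by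
    simpa using (hlim.comp (tendsto_add_atTop_nat 1)).sub hlim
  have hpos : 0 < u 0 j := lt_of_le_of_ne (hu0 0 j) (Ne.symm hj)
  have hother : ∀ k, k ≠ j → Tendsto (fun n => u n k) atTop (𝓝 0) := by
    intro k hkj
    by_cases hk : k ∈ supp x
    · have hAk := hdom k hk hkj
      have hc : 0 < u 0 j * A j k := mul_pos hpos hAk
      refine squeeze_zero (fun n => hu0 n k) (fun n => ?_)
        (by simpa only [mul_zero] using hdiff.const_mul (u 0 j * A j k)⁻¹)
      rw [le_inv_mul_iff₀ hc, hsucc]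
      have h1 : A j k * u n k ≤ ∑ i, A j i * u n i :=
        Finset.single_le_sum (f := fun i => A j i * u n i) (fun i _ => hterm n i)
          (Finset.mem_univ k)
      have h2 : u 0 j ≤ u n j := hmono (Nat.zero_le n)
      have h3 := mul_le_mul h2 h1 (hterm n k) (hu0 n j)
      linarith
    · simp only [hsupp _ k hk]
      exact tendsto_const_nhds
  refine tendsto_simplex_iff.2 fun k => ?_
  rw [vertex_apply]
  split_ifs with hkj
  · subst hkj
    have hsum := tendsto_finsetSum (Finset.univ.erase k)
      fun i hi => hother i (Finset.ne_of_mem_erase hi)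
    rw [Finset.sum_const_zero] at hsum
    have := hsum.const_sub 1
    rw [sub_zero] at this
    refine this.congr fun n => ?_
    have h1 : ∑ i, u n i = 1 := (V^[n] x).2.2
    rw [← Finset.add_sum_erase _ _ (Finset.mem_univ k)] at h1
    linarith
  · exact hother k hkj

/-! ### Cyclic triples -/

/-- A point of the open face spanned by three indices, with prescribed barycentric
coordinates. -/
lemma exists_simplex_of_three {i j k : Fin m} (hij : i ≠ j) (hjk : j ≠ k) (hki : k ≠ i)
    {r s t : ℝ} (hr : 0 < r) (hs : 0 < s) (ht : 0 < t) (hsum : r + s + t = 1) :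
    ∃ x : simplex m, x.1 i = r ∧ x.1 j = s ∧ x.1 k = t ∧ supp x = {i, j, k} := by
  have hzero : ∀ l, l ≠ i → l ≠ j → l ≠ k → (r • EuclideanSpace.single i (1 : ℝ) +
      s • EuclideanSpace.single j 1 + t • EuclideanSpace.single k 1 :
        EuclideanSpace ℝ (Fin m)) l = 0 := by
    intro l h1 h2 h3
    simp [h1, h2, h3]
  refine ⟨⟨r • EuclideanSpace.single i (1 : ℝ) + s • EuclideanSpace.single j 1 +
    t • EuclideanSpace.single k 1, fun l => ?_, ?_⟩, ?_, ?_, ?_, ?_⟩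
  · simp only [PiLp.add_apply, PiLp.smul_apply, PiLp.single_apply, smul_eq_mul]
    split_ifs <;> linarith
  · simp [Finset.sum_add_distrib, hsum]
  · simp [hij, hki.symm]
  · simp [hij.symm, hjk]
  · simp [hki, hjk.symm]
  · ext l
    simp only [supp, Set.mem_ofPred_eq, Set.mem_insert_iff, Set.mem_singleton_iff]
    constructor
    · intro h
      by_contra! hl
      exact h (hzero l hl.1 hl.2.1 hl.2.2)
    · rintro (rfl | rfl | rfl)
      · simpa [hij, hki.symm] using hr.ne'
      · simpa [hij.symm, hjk] using hs.ne'
      · simpa [hki, hjk.symm] using ht.ne'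

lemma sum_eq_of_supp_subset {i j k : Fin m} (hij : i ≠ j) (hjk : j ≠ k) (hki : k ≠ i)
    {x : simplex m} (hx : supp x = {i, j, k}) (f : Fin m → ℝ) :
    ∑ l, f l * x.1 l = f i * x.1 i + f j * x.1 j + f k * x.1 k := by
  rw [← Finset.sum_subset (Finset.subset_univ {i, j, k})]
  · rw [Finset.sum_insert (by simp [hij, hki.symm]), Finset.sum_pair hjk, add_assoc]
  · intro l _ hl
    have hl' : l ∉ supp x := by rw [hx]; simpa using hl
    have : x.1 l = 0 := by simpa [supp] using hl'
    rw [this, mul_zero]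

lemma isTransitiveTournament_of_tendsto_steps (hA : IsGivenBy V A)
    (h : ∀ x : simplex m,
      Tendsto (fun n : ℕ => ‖(V^[n] x).1 - (V^[n + 1] x).1‖) atTop (𝓝 0)) :
    IsTransitiveTournament (tournament A) := by
  rintro ⟨i, j, k, hij, hjk, hki, ⟨-, hc⟩, ⟨-, ha⟩, ⟨-, hb⟩⟩
  set p := -A j k / (-A j k + -A k i + -A i j) with hp
  have hp0 : 0 < p := div_pos (by linarith) (by linarith)
  have hp1 : p < 1 := (div_lt_one (by linarith)).2 (by linarith)
  -- Halving the first coordinate of the interior fixed point gives a different interior point.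
  obtain ⟨x, hxi, hxj, hxk, hx⟩ := exists_simplex_of_three hij hjk hki
    (r := p / 2) (s := (1 - p / 2) / 2) (t := (1 - p / 2) / 2) (by linarith) (by linarith)
    (by linarith) (by ring)
  have hsupp : ∀ n, supp (V^[n] x) = {i, j, k} := fun n => by rw [hA.supp_iterate, hx]
  have hpos : ∀ n l, l ∈ ({i, j, k} : Set (Fin m)) → 0 < (V^[n] x).1 l := by
    intro n l hl
    rw [← hsupp n] at hl
    exact lt_of_le_of_ne ((V^[n] x).2.1 l) (Ne.symm hl)
  have hsucc : ∀ n l, (V^[n + 1] x).1 l = (V^[n] x).1 l *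
      (1 + (A l i * (V^[n] x).1 i + A l j * (V^[n] x).1 j + A l k * (V^[n] x).1 k)) := by
    intro n l
    rw [Function.iterate_succ_apply', hA.apply_eq,
      sum_eq_of_supp_subset hij hjk hki (hsupp n) (A l)]
  have hstep : ∀ l, Tendsto (fun n => (V^[n + 1] x).1 l - (V^[n] x).1 l) atTop (𝓝 0) := by
    intro l
    refine squeeze_zero_norm (fun n => ?_) (h x)
    rw [norm_sub_rev]
    exact PiLp.norm_apply_le ((V^[n] x).1 - (V^[n + 1] x).1) l
  refine not_tendsto_steps_of_cyclic (x := fun n => (V^[n] x).1 i) (y := fun n => (V^[n] x).1 j)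
    (z := fun n => (V^[n] x).1 k) (a := -A j k) (b := -A k i) (c := -A i j) (by linarith)
    (by linarith) (by linarith) (fun n => hpos n i (by simp)) (fun n => hpos n j (by simp))
    (fun n => hpos n k (by simp)) (fun n => ?_) (fun n => ?_) (fun n => ?_) (fun n => ?_) ?_
    (hstep i) (hstep j) (hstep k)
  · have := sum_eq_of_supp_subset hij hjk hki (hsupp n) fun _ => 1
    simp only [one_mul] at this
    rw [← this]
    exact (V^[n] x).2.2
  · rw [hsucc, hA.apply_self, hA.apply_swap k i]
    ring
  · rw [hsucc, hA.apply_self, hA.apply_swap i j]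
    ring
  · rw [hsucc, hA.apply_self, hA.apply_swap j k]
    ring
  · change x.1 i ≠ p
    rw [hxi]
    linarith

lemma tendsto_norm_sub_zero {u v : ℕ → simplex m} {p : simplex m} (hu : Tendsto u atTop (𝓝 p))
    (hv : Tendsto v atTop (𝓝 p)) : Tendsto (fun n => ‖(u n).1 - (v n).1‖) atTop (𝓝 0) := by
  simpa using ((tendsto_subtype_rng.1 hu).sub (tendsto_subtype_rng.1 hv)).norm

end QuadraticStochastic

open QuadraticStochastic
theorem mainTheorem1 (m : ℕ) (V : simplex m → simplex m) (hV : IsVolterra V)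
    (A : Matrix (Fin m) (Fin m) ℝ) (hA : IsGivenBy V A) (hT : IsTransversal A) :
    List.TFAE
      [IsRegularOperator V,
       IsTransitiveTournament (tournament A),
       ErgodicPrinciple V,
       ∀ x : simplex m, Tendsto (fun n : ℕ => ‖(V^[n] x).1 - (V^[n + 1] x).1‖) atTop (𝓝 0)] := by
  tfae_have 2 → 1 := by
    intro h x
    obtain ⟨j, hj, hdom⟩ := exists_dominant_of_transitive hA hT h x
    exact ⟨vertex j, hA.apply_vertex j, tendsto_vertex_of_dominant hA x hj hdom⟩
  tfae_have 2 → 3 := by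
    intro h x y hxy
    obtain ⟨j, hj, hdom⟩ := exists_dominant_of_transitive hA hT h x
    exact tendsto_norm_sub_zero (tendsto_vertex_of_dominant hA x hj hdom)
      (tendsto_vertex_of_dominant hA y (hxy ▸ hj) (hxy ▸ hdom))
  tfae_have 1 → 4 := by
    intro h x
    obtain ⟨p, -, hp⟩ := h x
    exact tendsto_norm_sub_zero hp (hp.comp (tendsto_add_atTop_nat 1))
  tfae_have 3 → 4 := by
    intro h x
    simpa only [Function.iterate_succ_apply] using h x (V x) (hA.supp_apply x).symm
  tfae_have 4 → 2 := isTransitiveTournament_of_tendsto_steps hA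
  tfae_finish
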